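/- Let $X$ and $Y$ be Banach spaces over $\mathbb{K}\in\{\mathbb{R},\mathbb{C}\}$, with $X$ separable and reflexive. Let $\mathcal{L}\subset B(X,Y)$ be a collection of bounded linear operators, equipped with a Hausdorff, locally compact, $\sigma$-compact topology $\tau$ such that for every $x\in X$ the map $L\mapsto Lx$ is continuous from $(\mathcal{L},\tau)$ to $Y$. Put $$M=M(X,\mathcal{L})=\Big\{x\in X:\ \|x\|_M:=\sup_{L\in\mathcal{L}}\|Lx\|_Y<\infty\Big\},\qquad M_0=M_0(X,\mathcal{L})=\Big\{x\in M:\ \lim_{L\to\infty}\|Lx\|_Y=0\Big\},$$ where $L\to\infty$ means that $L$ leaves every compact subset of $(\mathcal{L},\tau)$ (so $M_0=M$ if $\mathcal{L}$ is compact). Suppose that $M$ is dense in $X$ and is a Banach space, continuously contained in $X$, under the norm $\|\cdot\|_M$; equip $M_0$ with the norm of $M$. Assume that for every $x\in M$ there is a sequence $(x_n)_{n\ge1}$ in $M_0$ with $\sup_n\|x_n\|_M\le\|x\|_M$ that converges to $x$ weakly in $X$. A closed subspace $J$ of a Banach space $Z$ is an M-ideal in $Z$ if its annihilator $J^\perp\subset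 Z^*$ is the range of a linear projection $P$ on $Z^*$ with $\|f\|=\|Pf\|+\|f-Pf\|$ for all $f\in Z^*$. **Theorem.** $M_0$ is an M-embedded Banach space; that is, $M_0$ is a Banach space which is an M-ideal in its bidual $M_0^{**}$. Moreover $M_0^{**}\simeq M$: there is a surjective linear isometry $I:M_0^{**}\to M$, acting as the identity on $M_0$ and given by $\varphi(Iz)=z(\varphi|_{M_0})$ for $z\in M_0^{**}$, $\varphi\in X^*$; and $M_0$ is an M-ideal in $M$. Equivalently, the canonical decomposition of the third dual is an $\ell^1$-decomposition, $$M_0^{***}=M_0^*\oplus_1 M_0^\perp,$$ that is, $M_0^{***}$ is the direct sum of the canonical image of $M_0^*$ and of the annihilator $M_0^\perp$ of $M_0\subset M_0^{**}$, and $\|f+s\|=\|f\|+\|s\|$ for all $f\in M_0^*$ and $s\in M_0^\perp$. -/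

import Mathlib

set_option maxSynthPendingDepth 3

open Filter Topology

noncomputable section

/-! ### M-ideals -/

section MIdeals

variable (𝕜 : Type*) [RCLike 𝕜]

/-- The annihilator `J^⊥ ⊆ Z*` of a subspace `J ⊆ Z`. -/
def annihilator {𝕜 : Type*} [RCLike 𝕜] {Z : Type*} [NormedAddCommGroup Z] [NormedSpace 𝕜 Z]
    (J : Submodule 𝕜 Z) : Submodule 𝕜 (StrongDual 𝕜 Z) where
  carrier := {f | ∀ z ∈ J, f z = 0}
  add_mem' := fun {f g} hf hg z hz => by
    simp [hf z hz, hg z hz]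
  zero_mem' := fun z _ => by simp
  smul_mem' := fun c f hf z hz => by simp [hf z hz]

/-- `J` is an M-ideal in `Z`: it is a closed subspace whose annihilator in `Z*` is the range of
an L-projection, i.e. of a projection `P` of `Z*` with `‖f‖ = ‖P f‖ + ‖f - P f‖` for all `f`. -/
def IsMIdeal {𝕜 : Type*} [RCLike 𝕜] {Z : Type*} [NormedAddCommGroup Z] [NormedSpace 𝕜 Z]
    (J : Submodule 𝕜 Z) : Prop :=
  IsClosed (J : Set Z) ∧
    ∃ P : StrongDual 𝕜 Z →L[𝕜] StrongDual 𝕜 Z,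
      IsLprojection (StrongDual 𝕜 Z) P ∧ P.range = annihilator J

/-- The canonical image of `Z` in its bidual `Z**`. -/
def canonicalImage (Z : Type*) [NormedAddCommGroup Z] [NormedSpace 𝕜 Z] :
    Submodule 𝕜 (StrongDual 𝕜 (StrongDual 𝕜 Z)) :=
  (NormedSpace.inclusionInDoubleDual 𝕜 Z).range

/-- `Z` is an M-embedded Banach space: `Z` is complete, and it is an M-ideal in its bidual. -/
structure IsMEmbedded (Z : Type*) [NormedAddCommGroup Z] [NormedSpace 𝕜 Z] : Prop where
  complete : CompleteSpace Z
  isMIdeal : IsMIdeal (canonicalImage 𝕜 Z)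

end MIdeals

/-! ### The big space `M(X, 𝓛)` and the little space `M₀(X, 𝓛)` -/

section Spaces

variable {𝕜 : Type*} [RCLike 𝕜]
  {X : Type*} [NormedAddCommGroup X] [NormedSpace 𝕜 X]
  {Y : Type*} [NormedAddCommGroup Y] [NormedSpace 𝕜 Y]

/-- `M(X, 𝓛)` as a linear subspace of `X`: all `x` with `sup_{L ∈ 𝓛} ‖L x‖ < ∞`. -/
def bigSubmodule (𝓛 : Set (X →L[𝕜] Y)) : Submodule 𝕜 X where
  carrier := {x | BddAbove (Set.range fun L : 𝓛 => ‖(L : X →L[𝕜] Y) x‖)}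
  add_mem' := by
    rintro x y ⟨a, ha⟩ ⟨b, hb⟩
    refine ⟨a + b, ?_⟩
    rintro _ ⟨L, rfl⟩
    have h1 := ha ⟨L, rfl⟩
    have h2 := hb ⟨L, rfl⟩
    simp only [map_add] at h1 h2 ⊢
    exact (norm_add_le _ _).trans (add_le_add h1 h2)
  zero_mem' := ⟨0, by rintro _ ⟨L, rfl⟩; simp⟩
  smul_mem' := by
    rintro c x ⟨a, ha⟩
    refine ⟨‖c‖ * a, ?_⟩
    rintro _ ⟨L, rfl⟩
    have h1 := ha ⟨L, rfl⟩
    simp only [map_smul, norm_smul] at h1 ⊢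
    exact mul_le_mul_of_nonneg_left h1 (norm_nonneg c)

/-- The space `M(X, 𝓛)`, as a type of its own: it does not carry the norm and topology of `X`
but those of `‖x‖_M = sup_{L ∈ 𝓛} ‖L x‖`. -/
def Big (𝓛 : Set (X →L[𝕜] Y)) : Type _ := bigSubmodule 𝓛

namespace Big

variable (𝓛 : Set (X →L[𝕜] Y))

instance : AddCommGroup (Big 𝓛) := inferInstanceAs (AddCommGroup (bigSubmodule 𝓛))

instance : Module 𝕜 (Big 𝓛) := inferInstanceAs (Module 𝕜 (bigSubmodule 𝓛))

/-- The inclusion `M(X, 𝓛) ⊆ X`. -/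
def incl : Big 𝓛 →ₗ[𝕜] X := (bigSubmodule 𝓛).subtype

instance : Norm (Big 𝓛) := ⟨fun x => ⨆ L : 𝓛, ‖(L : X →L[𝕜] Y) (incl 𝓛 x)‖⟩

theorem norm_def (x : Big 𝓛) : ‖x‖ = ⨆ L : 𝓛, ‖(L : X →L[𝕜] Y) (incl 𝓛 x)‖ := rfl

theorem bddAbove (x : Big 𝓛) :
    BddAbove (Set.range fun L : 𝓛 => ‖(L : X →L[𝕜] Y) (incl 𝓛 x)‖) := x.2

theorem norm_apply_le (x : Big 𝓛) (L : 𝓛) : ‖(L : X →L[𝕜] Y) (incl 𝓛 x)‖ ≤ ‖x‖ :=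
  le_ciSup (bddAbove 𝓛 x) L

theorem seminormCore : SeminormedSpace.Core 𝕜 (Big 𝓛) where
  norm_nonneg x := Real.iSup_nonneg fun L => norm_nonneg _
  norm_smul c x := by
    simp only [norm_def, map_smul, norm_smul]
    rw [Real.mul_iSup_of_nonneg (norm_nonneg c)]
  norm_triangle x y := by
    refine Real.iSup_le (fun L => ?_) (add_nonneg (Real.iSup_nonneg fun L => norm_nonneg _)
      (Real.iSup_nonneg fun L => norm_nonneg _))
    rw [map_add, map_add]
    exact (norm_add_le _ _).trans (add_le_add (norm_apply_le 𝓛 x L) (norm_apply_le 𝓛 y L))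

/-- `M(X, 𝓛)` is continuously contained in `X`: `‖x‖_X ≤ C ‖x‖_M` on `M(X, 𝓛)`, for some
constant `C`. In particular the seminorm `‖·‖_M` is a norm. -/
class ContinuouslyContained : Prop where
  bound : ∃ C : ℝ, ∀ x : Big 𝓛, ‖incl 𝓛 x‖ ≤ C * ‖x‖

variable [ContinuouslyContained 𝓛]

theorem normCore : NormedSpace.Core 𝕜 (Big 𝓛) where
  toCore := seminormCore 𝓛
  norm_eq_zero_iff x := by
    refine ⟨fun h => ?_, fun h => by subst h; simp [norm_def]⟩
    obtain ⟨C, hC⟩ := ContinuouslyContained.bound (𝓛 := 𝓛)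
    have h1 := hC x
    rw [h, mul_zero, norm_le_zero_iff] at h1
    exact Subtype.ext h1

instance : NormedAddCommGroup (Big 𝓛) := NormedAddCommGroup.ofCore (normCore 𝓛)

instance : NormedSpace 𝕜 (Big 𝓛) := NormedSpace.ofCore (normCore 𝓛)

/-- The inclusion `M(X, 𝓛) ⊆ X` as a bounded operator. -/
def inclL : Big 𝓛 →L[𝕜] X :=
  (incl 𝓛).mkContinuousOfExistsBound ContinuouslyContained.bound

end Big

/-- The space `M₀(X, 𝓛)`, as a subspace of `M(X, 𝓛)` with the norm of `M(X, 𝓛)`: all `x` such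
that `‖L x‖ → 0` as `L` leaves all compact subsets of `(𝓛, τ)`. -/
def Little (𝓛 : Set (X →L[𝕜] Y)) (τ : TopologicalSpace 𝓛) : Submodule 𝕜 (Big 𝓛) where
  carrier := {x | Tendsto (fun L : 𝓛 => ‖(L : X →L[𝕜] Y) (Big.incl 𝓛 x)‖)
    (@cocompact 𝓛 τ) (𝓝 0)}
  add_mem' := by
    intro x y hx hy
    refine squeeze_zero (fun _ => norm_nonneg _) (fun L => ?_) (by simpa using hx.add hy)
    rw [map_add, map_add]
    exact norm_add_le _ _
  zero_mem' := by simpa using tendsto_const_nhds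
  smul_mem' := by
    intro c x hx
    have h := hx.const_mul ‖c‖
    simpa [norm_smul] using h

/-- For every `x ∈ M` there is a sequence in `M₀`, bounded by `‖x‖_M` in the norm of `M`, which
converges to `x` weakly in `X`. -/
def ApproximationProperty (𝓛 : Set (X →L[𝕜] Y)) (τ : TopologicalSpace 𝓛) : Prop :=
  ∀ x : Big 𝓛, ∃ u : ℕ → Big 𝓛, (∀ n, u n ∈ Little 𝓛 τ) ∧ (∀ n, ‖u n‖ ≤ ‖x‖) ∧
    ∀ φ : StrongDual 𝕜 X, Tendsto (fun n => φ (Big.incl 𝓛 (u n))) atTop (𝓝 (φ (Big.incl 𝓛 x)))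

/-- The map `J : X* → M₀*` that restricts functionals on `X` to `M₀`. -/
def restrictToLittle (𝓛 : Set (X →L[𝕜] Y)) [Big.ContinuouslyContained 𝓛]
    (τ : TopologicalSpace 𝓛) (φ : StrongDual 𝕜 X) : StrongDual 𝕜 (Little 𝓛 τ) :=
  φ ∘L Big.inclL 𝓛 ∘L (Little 𝓛 τ).subtypeL

end Spaces

end

/-! Everything rests on the inequality `‖f‖ + ‖s‖ ≤ ‖f + s‖` in the third dual
(`norm_add_of_approx`). Let `x` in the ball of `M₀` nearly norm `f`, and `z` in the ball of `M₀**`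
nearly norm `s`. If some `y` in `M₀` has `f y ≈ z f` and `‖x + z - y‖ ≤ 1 + ε`, then testing `f + s`
on `x - y + z` suffices, because `s` kills `x - y`.

To find `y`, regard `z` as an element of `M`. The operators split in two: on a compact set they are
uniformly bounded, so `L (z - y)` is small once `z - y` is small in `X`; off it `L x` is small, and
`‖z - y‖_M ≤ 1 + ε` is enough. The approximation property gives only the bound `2` for `‖z - y‖_M`;
averaging two approximants, the second chosen after the first, shrinks the excess over `1` by the
factor `3/4` (`exists_little_norm_sub_le_pow`).

The link with `X` is the density of `X*` in `M₀*` (`exists_norm_sub_comp_le`): `M₀` embeds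
isometrically in `C₀(𝓛, Y)`, where functionals almost live on compact sets, and a compactly cut-off
orbit `L ↦ L x` makes sense for every `x` in `X`. Density gives `f y ≈ z f` and the injectivity of
`M₀** → M`; reflexivity defines this map, and weak-star compactness makes it onto and isometric. -/

open scoped ZeroAtInfty

/-! ### M-ideals, the third dual and weak limits. -/

section Duality

variable {𝕜 : Type*} [RCLike 𝕜] {Z : Type*} [NormedAddCommGroup Z] [NormedSpace 𝕜 Z]

theorem mem_annihilator {J : Submodule 𝕜 Z} {f : StrongDual 𝕜 Z} :
    f ∈ annihilator J ↔ ∀ z ∈ J, f z = 0 := Iff.rfl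

theorem exists_norm_le_one_lt_re_apply (f : StrongDual 𝕜 Z) {r : ℝ} (hr : r < ‖f‖) :
    ∃ x : Z, ‖x‖ ≤ 1 ∧ r < RCLike.re (f x) := by
  obtain ⟨x, hx, hrx⟩ := f.exists_lt_apply_of_lt_opNorm hr
  obtain ⟨c, hc, h⟩ := RCLike.exists_norm_eq_mul_self (f x)
  refine ⟨c • x, by rw [norm_smul, hc, one_mul]; exact hx.le, ?_⟩
  rw [map_smul, smul_eq_mul, ← h, RCLike.ofReal_re]
  exact hrx

variable (𝕜 Z) in
/-- The canonical projection of `Z***` onto the canonical image of `Z*`. -/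
noncomputable def thirdDualProj :
    StrongDual 𝕜 (StrongDual 𝕜 (StrongDual 𝕜 Z)) →L[𝕜]
      StrongDual 𝕜 (StrongDual 𝕜 (StrongDual 𝕜 Z)) :=
  NormedSpace.inclusionInDoubleDual 𝕜 (StrongDual 𝕜 Z) ∘L
    (ContinuousLinearMap.compL 𝕜 Z (StrongDual 𝕜 (StrongDual 𝕜 Z)) 𝕜).flip
      (NormedSpace.inclusionInDoubleDual 𝕜 Z)

theorem thirdDualProj_apply (g : StrongDual 𝕜 (StrongDual 𝕜 (StrongDual 𝕜 Z))) :
    thirdDualProj 𝕜 Z g = NormedSpace.inclusionInDoubleDual 𝕜 (StrongDual 𝕜 Z)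
      (g ∘L NormedSpace.inclusionInDoubleDual 𝕜 Z) := rfl

theorem thirdDualProj_inclusionInDoubleDual (f : StrongDual 𝕜 Z) :
    thirdDualProj 𝕜 Z (NormedSpace.inclusionInDoubleDual 𝕜 (StrongDual 𝕜 Z) f) =
      NormedSpace.inclusionInDoubleDual 𝕜 (StrongDual 𝕜 Z) f := rfl

theorem mem_annihilator_canonicalImage {s : StrongDual 𝕜 (StrongDual 𝕜 (StrongDual 𝕜 Z))} :
    s ∈ annihilator (canonicalImage 𝕜 Z) ↔
      ∀ x, s (NormedSpace.inclusionInDoubleDual 𝕜 Z x) = 0 := by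
  rw [mem_annihilator]
  exact ⟨fun h x => h _ ⟨x, rfl⟩, by rintro h _ ⟨x, rfl⟩; exact h x⟩

theorem sub_thirdDualProj_mem_annihilator (g : StrongDual 𝕜 (StrongDual 𝕜 (StrongDual 𝕜 Z))) :
    g - thirdDualProj 𝕜 Z g ∈ annihilator (canonicalImage 𝕜 Z) := by
  rw [mem_annihilator_canonicalImage]
  intro x
  simp [thirdDualProj_apply]

theorem thirdDualProj_eq_zero {s : StrongDual 𝕜 (StrongDual 𝕜 (StrongDual 𝕜 Z))}
    (hs : s ∈ annihilator (canonicalImage 𝕜 Z)) : thirdDualProj 𝕜 Z s = 0 := by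
  have h : s ∘L NormedSpace.inclusionInDoubleDual 𝕜 Z = 0 :=
    ContinuousLinearMap.ext (mem_annihilator_canonicalImage.1 hs)
  rw [thirdDualProj_apply, h, map_zero]

variable (𝕜 Z) in
/-- The canonical decomposition of the third dual. -/
theorem isCompl_canonicalImage_annihilator :
    IsCompl (canonicalImage 𝕜 (StrongDual 𝕜 Z)) (annihilator (canonicalImage 𝕜 Z)) := by
  constructor
  · rw [Submodule.disjoint_def]
    rintro _ ⟨f, rfl⟩ hf
    exact (thirdDualProj_inclusionInDoubleDual f).symm.trans (thirdDualProj_eq_zero hf)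
  · rw [codisjoint_iff, Submodule.eq_top_iff']
    intro g
    rw [Submodule.mem_sup]
    exact ⟨thirdDualProj 𝕜 Z g, ⟨_, rfl⟩, _, sub_thirdDualProj_mem_annihilator g,
      add_sub_cancel _ _⟩

/-- If `Z*** = Z* ⊕₁ Z^⊥`, then `Z` is M-embedded. -/
theorem isMEmbedded_of_norm_add [CompleteSpace Z]
    (h : ∀ (f : StrongDual 𝕜 Z), ∀ s ∈ annihilator (canonicalImage 𝕜 Z),
      ‖NormedSpace.inclusionInDoubleDual 𝕜 (StrongDual 𝕜 Z) f + s‖ = ‖f‖ + ‖s‖) :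
    IsMEmbedded 𝕜 Z := by
  refine ⟨inferInstance, ?_, 1 - thirdDualProj 𝕜 Z, IsLprojection.Lcomplement ⟨?_, ?_⟩, ?_⟩
  · have := (NormedSpace.inclusionInDoubleDualLi 𝕜 (E := Z)).isometry.isClosedEmbedding
    exact this.isClosed_range
  · exact ContinuousLinearMap.ext fun g => rfl
  · intro g
    have h1 := h (g ∘L NormedSpace.inclusionInDoubleDual 𝕜 Z) _
      (sub_thirdDualProj_mem_annihilator g)
    rw [← thirdDualProj_apply, add_sub_cancel] at h1
    rw [h1]
    congr 1
    exact ((NormedSpace.inclusionInDoubleDualLi 𝕜).norm_map _).symm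
  · ext s
    constructor
    · rintro ⟨g, rfl⟩
      exact sub_thirdDualProj_mem_annihilator g
    · intro hs
      refine ⟨s, ?_⟩
      change s - thirdDualProj 𝕜 Z s = s
      rw [thirdDualProj_eq_zero hs, sub_zero]

/-- M-ideals are preserved by isometric isomorphisms. -/
theorem IsMIdeal.of_linearIsometryEquiv {W : Type*} [NormedAddCommGroup W] [NormedSpace 𝕜 W]
    (e : Z ≃ₗᵢ[𝕜] W) {J : Submodule 𝕜 Z} {J' : Submodule 𝕜 W} (he : ∀ z, z ∈ J ↔ e z ∈ J')
    (h : IsMIdeal J) : IsMIdeal J' := by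
  obtain ⟨hJ, P, hP, hPJ⟩ := h
  have hnorm : ∀ f : StrongDual 𝕜 W,
      ‖f ∘L (e.toContinuousLinearEquiv : Z →L[𝕜] W)‖ = ‖f‖ := fun f =>
    f.opNorm_comp_linearIsometryEquiv e
  have hnorm' : ∀ f : StrongDual 𝕜 Z,
      ‖f ∘L (e.symm.toContinuousLinearEquiv : W →L[𝕜] Z)‖ = ‖f‖ := fun f =>
    f.opNorm_comp_linearIsometryEquiv e.symm
  let A : StrongDual 𝕜 W →L[𝕜] StrongDual 𝕜 Z :=
    (ContinuousLinearMap.compL 𝕜 Z W 𝕜).flip (e.toContinuousLinearEquiv : Z →L[𝕜] W)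
  let B : StrongDual 𝕜 Z →L[𝕜] StrongDual 𝕜 W :=
    (ContinuousLinearMap.compL 𝕜 W Z 𝕜).flip (e.symm.toContinuousLinearEquiv : W →L[𝕜] Z)
  have hA : ∀ f z, A f z = f (e z) := fun _ _ => rfl
  have hB : ∀ f w, B f w = f (e.symm w) := fun _ _ => rfl
  have hAB : ∀ f, A (B f) = f := fun f => by ext z; simp [hA, hB]
  have hBA : ∀ f, B (A f) = f := fun f => by ext z; simp [hA, hB]
  refine ⟨?_, B ∘L P ∘L A, ⟨?_, ?_⟩, ?_⟩
  · have : (J' : Set W) = e.symm ⁻¹' (J : Set Z) := by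
      ext w
      simp [he]
    rw [this]
    exact hJ.preimage e.symm.continuous
  · refine ContinuousLinearMap.ext fun f => ?_
    change B (P (A (B (P (A f))))) = B (P (A f))
    rw [hAB]
    exact congrArg B (DFunLike.congr_fun hP.proj (A f))
  · intro f
    have h1 := hP.Lnorm (A f)
    change ‖A f‖ = ‖P (A f)‖ + ‖A f - P (A f)‖ at h1
    change ‖f‖ = ‖B (P (A f))‖ + ‖f - B (P (A f))‖
    have h2 : f - B (P (A f)) = B (A f - P (A f)) := by rw [map_sub, hBA]
    rw [h2, ← hnorm f]
    exact h1.trans (congrArg₂ _ (hnorm' _).symm (hnorm' _).symm)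
  · ext f
    have h1 : f ∈ annihilator J' ↔ A f ∈ annihilator J := by
      simp only [mem_annihilator, hA]
      exact ⟨fun h z hz => h _ ((he z).1 hz),
        fun h w hw => by simpa using h (e.symm w) ((he _).2 (by simpa using hw))⟩
    rw [h1, ← hPJ]
    constructor
    · rintro ⟨g, rfl⟩
      exact ⟨A g, (hAB _).symm⟩
    · rintro ⟨g, hg⟩
      refine ⟨B g, ?_⟩
      change B (P (A (B g))) = f
      rw [hAB, show P g = A f from hg, hBA]

/-- If bidual elements can be approximated from `Z` in a way that respects the max-norm of pairs,
then the canonical decomposition of the third dual is an `ℓ¹`-decomposition. -/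
theorem norm_add_of_approx
    (h : ∀ (x : Z) (z : StrongDual 𝕜 (StrongDual 𝕜 Z)) (f : StrongDual 𝕜 Z) (ε : ℝ), ‖x‖ ≤ 1 →
      ‖z‖ ≤ 1 → 0 < ε → ∃ y : Z, ‖z f - f y‖ ≤ ε ∧
        ‖NormedSpace.inclusionInDoubleDual 𝕜 Z (x - y) + z‖ ≤ 1 + ε)
    (f : StrongDual 𝕜 Z) {s : StrongDual 𝕜 (StrongDual 𝕜 (StrongDual 𝕜 Z))}
    (hs : s ∈ annihilator (canonicalImage 𝕜 Z)) :
    ‖NormedSpace.inclusionInDoubleDual 𝕜 (StrongDual 𝕜 Z) f + s‖ = ‖f‖ + ‖s‖ := by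
  refine le_antisymm ((norm_add_le _ _).trans
    (add_le_add_left (NormedSpace.double_dual_bound 𝕜 _ f) _)) ?_
  set g := NormedSpace.inclusionInDoubleDual 𝕜 (StrongDual 𝕜 Z) f + s with hg
  -- The `3` counts the errors in norming `f`, in norming `s` and in `f y ≈ z f`; the test vector of
  -- norm at most `1 + ε` costs `ε * ‖g‖`.
  have key : ∀ ε : ℝ, 0 < ε → ‖f‖ + ‖s‖ ≤ ‖g‖ + ε * (‖g‖ + 3) := by
    intro ε hε
    obtain ⟨x, hx, hfx⟩ := exists_norm_le_one_lt_re_apply f (sub_lt_self ‖f‖ hε)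
    obtain ⟨z, hz, hsz⟩ := exists_norm_le_one_lt_re_apply s (sub_lt_self ‖s‖ hε)
    obtain ⟨y, hy, hxyz⟩ := h x z f ε hx hz hε
    have h1 : g (NormedSpace.inclusionInDoubleDual 𝕜 Z (x - y) + z) = f x + (z f - f y) + s z := by
      have := mem_annihilator_canonicalImage.1 hs (x - y)
      rw [hg, _root_.add_apply, map_add s, this, NormedSpace.dual_def,
        _root_.add_apply, NormedSpace.dual_def, map_sub]
      ring
    have h2 := (RCLike.re_le_norm _).trans (g.le_of_opNorm_le_of_le le_rfl hxyz)
    rw [h1, map_add, map_add] at h2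
    have h3 := (RCLike.abs_re_le_norm _).trans hy
    have h4 := (abs_le.1 h3).1
    linarith
  have hlim : Tendsto (fun ε : ℝ => ‖g‖ + ε * (‖g‖ + 3)) (𝓝[>] 0) (𝓝 (‖g‖ + 0 * (‖g‖ + 3))) :=
    Tendsto.mono_left (Continuous.tendsto (by fun_prop) 0) nhdsWithin_le_nhds
  rw [zero_mul, add_zero] at hlim
  exact ge_of_tendsto hlim (eventually_nhdsWithin_of_forall key)

/-- A weakly convergent bounded sequence defines an element of the bidual. -/
theorem exists_bidual_of_tendsto {X : Type*} [NormedAddCommGroup X] [NormedSpace 𝕜 X]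
    (i : Z →L[𝕜] X) {u : ℕ → Z} {r : ℝ} (hu : ∀ n, ‖u n‖ ≤ r) {x : X}
    (hx : ∀ φ : StrongDual 𝕜 X, Tendsto (fun n => φ (i (u n))) atTop (𝓝 (φ x))) :
    ∃ z : StrongDual 𝕜 (StrongDual 𝕜 Z), ‖z‖ ≤ r ∧ ∀ φ : StrongDual 𝕜 X, z (φ ∘L i) = φ x := by
  let v : ℕ → WeakDual 𝕜 (StrongDual 𝕜 Z) := fun n =>
    StrongDual.toWeakDual (NormedSpace.inclusionInDoubleDual 𝕜 Z (u n))
  have hK := WeakDual.isCompact_closedBall (𝕜 := 𝕜) (0 : StrongDual 𝕜 (StrongDual 𝕜 Z)) r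
  -- Weak-star compactness need not yield a convergent subsequence, so the limit is taken along an
  -- ultrafilter.
  obtain ⟨z, hz, hvz⟩ := hK.ultrafilter_le_nhds ((hyperfilter ℕ).map v) (by
    rw [le_principal_iff]
    refine Filter.mem_map.2 (Filter.univ_mem' fun n => ?_)
    simpa [v] using (NormedSpace.double_dual_bound 𝕜 Z (u n)).trans (hu n))
  refine ⟨WeakDual.toStrongDual z, by simpa using hz, fun φ => ?_⟩
  have h1 : Tendsto (fun n => v n (φ ∘L i)) (hyperfilter ℕ) (𝓝 (z (φ ∘L i))) :=
    ((WeakDual.eval_continuous (φ ∘L i)).tendsto z).comp hvz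
  exact tendsto_nhds_unique h1 ((hx φ).mono_left Nat.hyperfilter_le_atTop)

/-- A weak limit of a sequence in a convex set lies in its norm closure (Mazur). -/
theorem mem_closure_of_tendsto_weakly {X : Type*} [NormedAddCommGroup X] [NormedSpace 𝕜 X]
    {S : Set X} (hS : letI := NormedSpace.restrictScalars ℝ 𝕜 X; Convex ℝ S) {u : ℕ → X}
    (hu : ∀ n, u n ∈ S) {x : X}
    (hx : ∀ φ : StrongDual 𝕜 X, Tendsto (fun n => φ (u n)) atTop (𝓝 (φ x))) :
    x ∈ closure S := by
  let := NormedSpace.restrictScalars ℝ 𝕜 X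
  have : IsScalarTower ℝ 𝕜 X := RestrictScalars.isScalarTower ℝ 𝕜 X
  by_contra hxS
  obtain ⟨φ, c, hc, hcx⟩ :=
    RCLike.geometric_hahn_banach_closed_point (𝕜 := 𝕜) hS.closure isClosed_closure hxS
  have h1 := (RCLike.continuous_re.tendsto _).comp (hx φ)
  exact hcx.not_ge (le_of_tendsto' h1 fun n => (hc _ (subset_closure (hu n))).le)

end Duality

/-! ### Functionals on `C₀(Λ, Y)` and density of `X*`. -/

section Operators

variable {𝕜 : Type*} [RCLike 𝕜]
  {X : Type*} [NormedAddCommGroup X] [NormedSpace 𝕜 X]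
  {Y : Type*} [NormedAddCommGroup Y] [NormedSpace 𝕜 Y]
  {Λ : Type*} [TopologicalSpace Λ]

/-- A strongly continuous family of operators is uniformly bounded on compact sets. -/
theorem exists_opNorm_le_of_isCompact [CompleteSpace X] {T : Λ → X →L[𝕜] Y}
    (hT : ∀ x, Continuous fun L => T L x) {K : Set Λ} (hK : IsCompact K) :
    ∃ C : ℝ, 0 < C ∧ ∀ L ∈ K, ‖T L‖ ≤ C := by
  obtain ⟨C, hC⟩ := banach_steinhaus (g := fun L : K => T L) fun x => by
    obtain ⟨C, hC⟩ := hK.exists_bound_of_continuousOn (hT x).continuousOn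
    exact ⟨C, fun L => hC L L.2⟩
  exact ⟨max C 1, by positivity, fun L hL => (hC ⟨L, hL⟩).trans (le_max_left _ _)⟩

theorem ZeroAtInftyContinuousMap.norm_apply_le (f : C₀(Λ, Y)) (L : Λ) : ‖f L‖ ≤ ‖f‖ :=
  f.toBCF.norm_coe_le_norm L

theorem ZeroAtInftyContinuousMap.norm_le_of_forall {f : C₀(Λ, Y)} {c : ℝ} (hc : 0 ≤ c)
    (h : ∀ L, ‖f L‖ ≤ c) : ‖f‖ ≤ c :=
  (BoundedContinuousFunction.norm_le (f := f.toBCF) hc).2 h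

/-- Functionals on `C₀(Λ, Y)` are concentrated on compact sets, up to a small error. -/
theorem exists_cutoff_norm_apply_le [T2Space Λ] [LocallyCompactSpace Λ]
    (F : StrongDual 𝕜 C₀(Λ, Y)) {ε : ℝ} (hε : 0 < ε) :
    ∃ χ : C(Λ, ℝ), HasCompactSupport χ ∧ (∀ L, χ L ∈ Set.Icc (0 : ℝ) 1) ∧
      ∀ h k : C₀(Λ, Y), (∀ L, k L = ((1 - χ L : ℝ) : 𝕜) • h L) → ‖F k‖ ≤ ε * ‖h‖ := by
  obtain ⟨δ, hδ, hδF⟩ : ∃ δ : ℝ, 0 < δ ∧ δ * (‖F‖ + 1) ≤ ε :=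
    ⟨ε / (‖F‖ + 1), by positivity, by rw [div_mul_cancel₀ _ (by positivity)]⟩
  obtain ⟨g, hg, hFg⟩ := exists_norm_le_one_lt_re_apply F (sub_lt_self ‖F‖ hδ)
  obtain ⟨K, hK, hgK⟩ := mem_cocompact.1
    ((zero_at_infty g).eventually (Metric.ball_mem_nhds (0 : Y) hδ))
  obtain ⟨χ, hχ1, -, hχs, hχ⟩ := exists_continuous_one_zero_of_isCompact hK isClosed_empty
    (Set.disjoint_empty K)
  refine ⟨χ, hχs, hχ, fun h k hk => ?_⟩
  -- `g` nearly norms `F` and is small off `K`, while `k` vanishes on `K`. Adding `a • k` thus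
  -- hardly raises the norm of `g`, which leaves `F` no room to be large on `k`.
  have key : ∀ a : 𝕜, ‖a‖ * ‖h‖ ≤ 1 → RCLike.re (a * F k) ≤ ε := by
    intro a ha
    have h1 : ‖g + a • k‖ ≤ 1 + δ := by
      refine ZeroAtInftyContinuousMap.norm_le_of_forall (by positivity) fun L => ?_
      rw [ZeroAtInftyContinuousMap.add_apply, ZeroAtInftyContinuousMap.smul_apply, hk]
      by_cases hL : L ∈ K
      · rw [hχ1 hL]
        simpa using (g.norm_apply_le L).trans (hg.trans (by linarith))
      · have h2 : ‖g L‖ ≤ δ := by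
          have := hgK hL
          simp only [Set.mem_ofPred_eq, dist_zero_right] at this
          exact this.le
        have h3 : ‖a • ((1 - χ L : ℝ) : 𝕜) • h L‖ ≤ 1 := by
          rw [norm_smul, norm_smul, RCLike.norm_ofReal,
            abs_of_nonneg (sub_nonneg.2 (hχ L).2)]
          have h4 := h.norm_apply_le L
          have h5 : (1 - χ L) * ‖h L‖ ≤ 1 * ‖h‖ :=
            mul_le_mul (by linarith [(hχ L).1]) h4 (norm_nonneg _) zero_le_one
          rw [one_mul] at h5
          exact (mul_le_mul_of_nonneg_left h5 (norm_nonneg a)).trans ha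
        exact (norm_add_le _ _).trans (by linarith)
    have h2 := (RCLike.re_le_norm _).trans (F.le_of_opNorm_le_of_le le_rfl h1)
    rw [map_add, map_smul, smul_eq_mul, map_add] at h2
    nlinarith
  obtain ⟨c, hc, hcF⟩ := RCLike.exists_norm_eq_mul_self (F k)
  rcases eq_or_ne h 0 with rfl | hh
  · have : k = 0 := by
      ext L
      simp [hk]
    simp [this]
  · have hpos : 0 < ‖h‖ := norm_pos_iff.2 hh
    -- The scalar normalises `h` and rotates `F k` onto the positive axis.
    have h1 := key (((‖h‖⁻¹ : ℝ) : 𝕜) * c) (by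
      rw [norm_mul, hc, RCLike.norm_ofReal, abs_of_nonneg (by positivity), mul_one,
        inv_mul_cancel₀ hpos.ne'])
    rw [mul_assoc, ← hcF, ← RCLike.ofReal_mul, RCLike.ofReal_re, inv_mul_le_iff₀ hpos] at h1
    linarith

/-- The functionals on `E` that come from `X` are norm dense in `E*`, if `E` is normed by a family
of operators on `X` that vanishes at infinity along the elements of `E`. -/
theorem exists_norm_sub_comp_le [CompleteSpace X] [T2Space Λ] [LocallyCompactSpace Λ]
    {T : Λ → X →L[𝕜] Y} (hT : ∀ x, Continuous fun L => T L x)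
    {E : Type*} [NormedAddCommGroup E] [NormedSpace 𝕜 E] (i : E →L[𝕜] X)
    (hle : ∀ x L, ‖T L (i x)‖ ≤ ‖x‖)
    (hge : ∀ x c, 0 ≤ c → (∀ L, ‖T L (i x)‖ ≤ c) → ‖x‖ ≤ c)
    (hzero : ∀ x, Tendsto (fun L => T L (i x)) (cocompact Λ) (𝓝 0))
    (f : StrongDual 𝕜 E) {ε : ℝ} (hε : 0 < ε) :
    ∃ φ : StrongDual 𝕜 X, ‖f - φ ∘L i‖ ≤ ε := by
  let V : E →ₗᵢ[𝕜] C₀(Λ, Y) :=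
    { toFun := fun x => ⟨⟨fun L => T L (i x), hT (i x)⟩, hzero x⟩
      map_add' := fun x y => by ext L; simp
      map_smul' := fun c x => by ext L; simp
      norm_map' := fun x => le_antisymm
        (ZeroAtInftyContinuousMap.norm_le_of_forall (norm_nonneg _) (hle x))
        (hge x _ (norm_nonneg _) fun L =>
          ZeroAtInftyContinuousMap.norm_apply_le (⟨⟨fun L => T L (i x), hT (i x)⟩, hzero x⟩ : C₀(Λ, Y)) L) }
  have hV : ∀ x L, V x L = T L (i x) := fun _ _ => rfl
  obtain ⟨F, hF, -⟩ := exists_extension_norm_eq (LinearMap.range V.toLinearMap)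
    (f ∘L (V.equivRange.symm.toContinuousLinearEquiv : _ →L[𝕜] E))
  have hFV : ∀ x, F (V x) = f x := fun x => by
    have h1 := hF (V.equivRange x)
    have h2 : ((V.equivRange x : LinearMap.range V.toLinearMap) : C₀(Λ, Y)) = V x := rfl
    rw [h2] at h1
    simpa using h1
  obtain ⟨χ, hχs, hχ, hFχ⟩ := exists_cutoff_norm_apply_le F hε
  obtain ⟨C, hC, hTC⟩ := exists_opNorm_le_of_isCompact hT hχs
  -- The orbit of a general `x` need be neither bounded nor vanishing at infinity; the cutoff
  -- repairs both, so `F` can be pulled back to all of `X`.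
  let W : X →ₗ[𝕜] C₀(Λ, Y) :=
    { toFun := fun x => ⟨⟨fun L => ((χ L : ℝ) : 𝕜) • T L x,
          (RCLike.continuous_ofReal.comp χ.continuous).smul (hT x)⟩, by
        refine tendsto_nhds_of_eventually_eq ?_
        filter_upwards [hχs.compl_mem_cocompact] with L hL
        simp [image_eq_zero_of_notMem_tsupport hL]⟩
      map_add' := fun x y => by ext L; simp
      map_smul' := fun c x => by
        ext L
        change ((χ L : ℝ) : 𝕜) • T L (c • x) = c • ((χ L : ℝ) : 𝕜) • T L x
        rw [map_smul, smul_comm] }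
  have hW : ∀ x L, W x L = ((χ L : ℝ) : 𝕜) • T L x := fun _ _ => rfl
  let Wc : X →L[𝕜] C₀(Λ, Y) := W.mkContinuous C fun x => by
    refine ZeroAtInftyContinuousMap.norm_le_of_forall (by positivity) fun L => ?_
    rw [hW, norm_smul, RCLike.norm_ofReal, abs_of_nonneg (hχ L).1]
    by_cases hL : L ∈ tsupport χ
    · have h1 := (T L).le_of_opNorm_le (hTC L hL) x
      exact (mul_le_of_le_one_left (norm_nonneg _) (hχ L).2).trans h1
    · rw [image_eq_zero_of_notMem_tsupport hL, zero_mul]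
      positivity
  refine ⟨F ∘L Wc, ContinuousLinearMap.opNorm_le_bound _ hε.le fun x => ?_⟩
  have h1 := hFχ (V x) (V x - Wc (i x)) fun L => by
    change T L (i x) - ((χ L : ℝ) : 𝕜) • T L (i x) = _
    rw [hV, RCLike.ofReal_sub, sub_smul, RCLike.ofReal_one, one_smul]
  rw [V.norm_map, map_sub, hFV] at h1
  exact h1

end Operators

/-! ### The spaces `M` and `M₀`, and approximation from `M₀`. -/

section Spaces

variable {𝕜 : Type*} [RCLike 𝕜]
  {X : Type*} [NormedAddCommGroup X] [NormedSpace 𝕜 X]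
  {Y : Type*} [NormedAddCommGroup Y] [NormedSpace 𝕜 Y]
  {𝓛 : Set (X →L[𝕜] Y)}

theorem Big.norm_le_of_forall [Big.ContinuouslyContained 𝓛] {x : Big 𝓛} {c : ℝ} (hc : 0 ≤ c)
    (h : ∀ L : 𝓛, ‖(L : X →L[𝕜] Y) (Big.incl 𝓛 x)‖ ≤ c) : ‖x‖ ≤ c :=
  Real.iSup_le h hc

theorem Big.incl_injective : Function.Injective (Big.incl 𝓛) :=
  (bigSubmodule 𝓛).injective_subtype

variable {τ : TopologicalSpace 𝓛}

theorem mem_little {x : Big 𝓛} : x ∈ Little 𝓛 τ ↔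
    Tendsto (fun L : 𝓛 => ‖(L : X →L[𝕜] Y) (Big.incl 𝓛 x)‖) (@cocompact 𝓛 τ) (𝓝 0) := Iff.rfl

/-- Outside of a compact set, the operators in `𝓛` are small at a given element of `M₀`; on this
compact set, they are uniformly bounded. -/
theorem exists_bound_of_mem_little [CompleteSpace X]
    (heval : ∀ x : X, @Continuous 𝓛 Y τ _ (fun L : 𝓛 => (L : X →L[𝕜] Y) x))
    {y : Big 𝓛} (hy : y ∈ Little 𝓛 τ) {ε : ℝ} (hε : 0 < ε) :
    ∃ C : ℝ, 0 < C ∧ ∀ L : 𝓛, ‖(L : X →L[𝕜] Y)‖ ≤ C ∨ ‖(L : X →L[𝕜] Y) (Big.incl 𝓛 y)‖ ≤ ε := by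
  obtain ⟨K, hK, hyK⟩ := (@mem_cocompact 𝓛 τ _).1
    (Filter.Tendsto.eventually (mem_little.1 hy) (Metric.closedBall_mem_nhds (0 : ℝ) hε))
  obtain ⟨C, hC, hCK⟩ := @exists_opNorm_le_of_isCompact 𝕜 _ X _ _ Y _ _ 𝓛 τ _
    (fun L => (L : X →L[𝕜] Y)) heval K hK
  refine ⟨C, hC, fun L => ?_⟩
  by_cases hL : L ∈ K
  · exact Or.inl (hCK L hL)
  · have := hyK hL
    simp only [Set.mem_ofPred_eq, dist_zero_right, norm_norm] at this
    exact Or.inr this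

variable [Big.ContinuouslyContained 𝓛]

variable (𝓛 τ) in
theorem isClosed_little : IsClosed (Little 𝓛 τ : Set (Big 𝓛)) := by
  refine isClosed_of_closure_subset fun x hx => ?_
  rw [SetLike.mem_coe, mem_little, Metric.tendsto_nhds]
  intro ε hε
  obtain ⟨y, hy, hxy⟩ := Metric.mem_closure_iff.1 hx (ε / 2) (half_pos hε)
  filter_upwards [Metric.tendsto_nhds.1 (mem_little.1 hy) (ε / 2) (half_pos hε)] with L hL
  rw [dist_zero_right, norm_norm] at hL ⊢
  have h1 := Big.norm_apply_le 𝓛 (x - y) L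
  rw [map_sub, map_sub] at h1
  rw [dist_eq_norm] at hxy
  linarith [norm_le_norm_add_norm_sub' ((L : X →L[𝕜] Y) (Big.incl 𝓛 x))
    ((L : X →L[𝕜] Y) (Big.incl 𝓛 y))]

/-- Mazur's theorem upgrades weak to norm approximation in `X`: the image of a ball of `M₀` is
convex, so convex combinations keep the `M`-norm bound. -/
theorem exists_little_norm_le_incl_sub_lt (happrox : ApproximationProperty 𝓛 τ) (z : Big 𝓛)
    {δ : ℝ} (hδ : 0 < δ) :
    ∃ y ∈ Little 𝓛 τ, ‖y‖ ≤ ‖z‖ ∧ ‖Big.incl 𝓛 (z - y)‖ < δ := by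
  obtain ⟨u, huM, hu, hlim⟩ := happrox z
  have h1 : Big.incl 𝓛 z ∈ closure (Big.incl 𝓛 '' {y | y ∈ Little 𝓛 τ ∧ ‖y‖ ≤ ‖z‖}) := by
    refine mem_closure_of_tendsto_weakly (𝕜 := 𝕜)
      (u := fun n => Big.incl 𝓛 (u n)) ?_ (fun n =>
        Set.mem_image_of_mem _ (And.intro (huM n) (hu n))) hlim
    rintro _ ⟨y, ⟨hy, hyz⟩, rfl⟩ _ ⟨w, ⟨hw, hwz⟩, rfl⟩ a b ha hb hab
    refine ⟨(a : 𝕜) • y + (b : 𝕜) • w, ⟨add_mem (Submodule.smul_mem _ _ hy)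
      (Submodule.smul_mem _ _ hw), ?_⟩, by rw [map_add, map_smul, map_smul]; rfl⟩
    refine (norm_add_le _ _).trans ?_
    rw [norm_smul, norm_smul, RCLike.norm_ofReal, RCLike.norm_ofReal, abs_of_nonneg ha,
      abs_of_nonneg hb]
    calc a * ‖y‖ + b * ‖w‖ ≤ a * ‖z‖ + b * ‖z‖ := by gcongr
      _ = ‖z‖ := by rw [← add_mul, hab, one_mul]
  obtain ⟨_, ⟨y, ⟨hy, hyz⟩, rfl⟩, h2⟩ := Metric.mem_closure_iff.1 h1 δ hδ
  exact ⟨y, hy, hyz, by rwa [map_sub, ← dist_eq_norm]⟩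

/-- Elements of the unit ball of `M` are approximated in `X` by elements of `M₀` such that the
`M`-norm of the difference is almost at most one. -/
theorem exists_little_norm_sub_le_pow [CompleteSpace X]
    (heval : ∀ x : X, @Continuous 𝓛 Y τ _ (fun L : 𝓛 => (L : X →L[𝕜] Y) x))
    (happrox : ApproximationProperty 𝓛 τ) {z : Big 𝓛} (hz : ‖z‖ ≤ 1) (n : ℕ) :
    ∀ δ : ℝ, 0 < δ → ∃ y ∈ Little 𝓛 τ, ‖Big.incl 𝓛 (z - y)‖ < δ ∧
      ‖z - y‖ ≤ 1 + (3 / 4) ^ n := by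
  induction n with
  | zero =>
    intro δ hδ
    obtain ⟨y, hy, hyz, hlt⟩ := exists_little_norm_le_incl_sub_lt happrox z hδ
    exact ⟨y, hy, hlt, (norm_sub_le _ _).trans (by linarith)⟩
  | succ n ih =>
    intro δ hδ
    set r : ℝ := (3 / 4) ^ n with hr
    have hr0 : 0 < r := by positivity
    obtain ⟨y₁, hy₁, hlt₁, hle₁⟩ := ih δ hδ
    obtain ⟨C, hC, hCy⟩ := exists_bound_of_mem_little heval hy₁ (half_pos hr0)
    -- `y₂` is chosen after `y₁`: where `‖L‖ ≤ C`, the radius forces `‖L (z - y₂)‖ ≤ r / 2`;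
    -- elsewhere `‖L y₁‖ ≤ r / 2`, so `‖L (z - y₁)‖ ≤ 1 + r / 2`. The sum is at most `2 + 3 * r / 2`
    -- in both cases.
    obtain ⟨y₂, hy₂, hlt₂, hle₂⟩ := ih (min δ (r / 2 / C)) (lt_min hδ (by positivity))
    rw [lt_min_iff, lt_div_iff₀ hC] at hlt₂
    have hsub : z - (2⁻¹ : 𝕜) • (y₁ + y₂) = (2⁻¹ : 𝕜) • ((z - y₁) + (z - y₂)) := by
      have : z = (2⁻¹ : 𝕜) • (z + z) := by
        rw [← two_smul 𝕜 z, smul_smul, inv_mul_cancel₀ two_ne_zero, one_smul]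
      conv_lhs => rw [this]
      rw [← smul_sub]
      congr 1
      abel
    have h2 : ‖(2⁻¹ : 𝕜)‖ = 2⁻¹ := by simp
    refine ⟨(2⁻¹ : 𝕜) • (y₁ + y₂), Submodule.smul_mem _ _ (add_mem hy₁ hy₂), ?_, ?_⟩
    · rw [hsub, map_smul, norm_smul, h2, map_add]
      have := norm_add_le (Big.incl 𝓛 (z - y₁)) (Big.incl 𝓛 (z - y₂))
      linarith [hlt₂.1]
    · rw [hsub, norm_smul, h2, pow_succ, ← hr]
      have key : ‖(z - y₁) + (z - y₂)‖ ≤ 2 + r + r / 2 := by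
        refine Big.norm_le_of_forall (by positivity) fun L => ?_
        rw [map_add, map_add]
        refine (norm_add_le _ _).trans ?_
        rcases hCy L with hL | hL
        · have h3 := (Big.norm_apply_le 𝓛 (z - y₁) L).trans hle₁
          have h4 := (L : X →L[𝕜] Y).le_of_opNorm_le hL (Big.incl 𝓛 (z - y₂))
          linarith [hlt₂.2]
        · have h3 := (Big.norm_apply_le 𝓛 (z - y₂) L).trans hle₂
          have h4 := (Big.norm_apply_le 𝓛 z L).trans hz
          have h5 := norm_sub_le ((L : X →L[𝕜] Y) (Big.incl 𝓛 z))
            ((L : X →L[𝕜] Y) (Big.incl 𝓛 y₁))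
          rw [← map_sub, ← map_sub] at h5
          linarith
      linarith

/-- For `x` in the unit ball of `M₀` and `z` in the unit ball of `M`, there are elements `y` of
`M₀`, close to `z` in `X`, such that the norm of `x + (z - y)` is almost at most one. -/
theorem exists_little_norm_add_sub_le [CompleteSpace X]
    (heval : ∀ x : X, @Continuous 𝓛 Y τ _ (fun L : 𝓛 => (L : X →L[𝕜] Y) x))
    (happrox : ApproximationProperty 𝓛 τ) {x z : Big 𝓛} (hxM : x ∈ Little 𝓛 τ) (hx : ‖x‖ ≤ 1)
    (hz : ‖z‖ ≤ 1) {ε δ : ℝ} (hε : 0 < ε) (hδ : 0 < δ) :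
    ∃ y ∈ Little 𝓛 τ, ‖Big.incl 𝓛 (z - y)‖ < δ ∧ ‖z - y‖ ≤ 1 + ε ∧ ‖x + (z - y)‖ ≤ 1 + ε := by
  obtain ⟨n, hn⟩ := exists_pow_lt_of_lt_one (half_pos hε) (show (3 / 4 : ℝ) < 1 by norm_num)
  obtain ⟨C, hC, hCx⟩ := exists_bound_of_mem_little heval hxM (half_pos hε)
  obtain ⟨y, hy, hlt, hle⟩ := exists_little_norm_sub_le_pow heval happrox hz n (min δ (ε / C))
    (lt_min hδ (by positivity))
  rw [lt_min_iff, lt_div_iff₀ hC] at hlt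
  refine ⟨y, hy, hlt.1, by linarith, Big.norm_le_of_forall (by positivity) fun L => ?_⟩
  rw [map_add, map_add]
  refine (norm_add_le _ _).trans ?_
  rcases hCx L with hL | hL
  · have h1 := (Big.norm_apply_le 𝓛 x L).trans hx
    have h2 := (L : X →L[𝕜] Y).le_of_opNorm_le hL (Big.incl 𝓛 (z - y))
    linarith [hlt.2]
  · have h1 := (Big.norm_apply_le 𝓛 (z - y) L).trans hle
    linarith

/-! ### The identification of `M₀**` with `M`. -/

/-- The restrictions to `M₀` of the functionals on `X` are norm dense in `M₀*`. -/
theorem exists_norm_sub_restrictToLittle_le [CompleteSpace X]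
    (hT2 : @T2Space 𝓛 τ) (hlc : @LocallyCompactSpace 𝓛 τ)
    (heval : ∀ x : X, @Continuous 𝓛 Y τ _ (fun L : 𝓛 => (L : X →L[𝕜] Y) x))
    (f : StrongDual 𝕜 (Little 𝓛 τ)) {ε : ℝ} (hε : 0 < ε) :
    ∃ φ : StrongDual 𝕜 X, ‖f - restrictToLittle 𝓛 τ φ‖ ≤ ε :=
  @exists_norm_sub_comp_le 𝕜 _ X _ _ Y _ _ 𝓛 τ _ hT2 hlc (fun L => (L : X →L[𝕜] Y)) heval
    (Little 𝓛 τ) _ _ (Big.inclL 𝓛 ∘L (Little 𝓛 τ).subtypeL)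
    (fun x L => Big.norm_apply_le 𝓛 (x : Big 𝓛) L)
    (fun _ _ hc h => Big.norm_le_of_forall hc h)
    (fun x => tendsto_zero_iff_norm_tendsto_zero.2 (mem_little.1 x.2)) f ε hε

/-- An element of the bidual of `M₀` is determined by its values on functionals on `X`. -/
theorem eq_zero_of_apply_restrictToLittle [CompleteSpace X]
    (hT2 : @T2Space 𝓛 τ) (hlc : @LocallyCompactSpace 𝓛 τ)
    (heval : ∀ x : X, @Continuous 𝓛 Y τ _ (fun L : 𝓛 => (L : X →L[𝕜] Y) x))
    {z : StrongDual 𝕜 (StrongDual 𝕜 (Little 𝓛 τ))}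
    (hz : ∀ φ, z (restrictToLittle 𝓛 τ φ) = 0) : z = 0 := by
  ext f
  refine norm_le_zero_iff.1 (le_of_forall_pos_le_add fun ε hε => ?_)
  obtain ⟨φ, hφ⟩ := exists_norm_sub_restrictToLittle_le hT2 hlc heval f
    (show 0 < ε / (‖z‖ + 1) by positivity)
  have h1 := z.le_of_opNorm_le_of_le (show ‖z‖ ≤ ‖z‖ + 1 by linarith) hφ
  rw [map_sub, hz, sub_zero, mul_div_cancel₀ _ (by positivity)] at h1
  linarith

/-- The element of `X` represented by an element of the bidual of `M₀` belongs to `M`. -/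
theorem norm_apply_le_of_bidual {z : StrongDual 𝕜 (StrongDual 𝕜 (Little 𝓛 τ))} {x : X}
    (hx : ∀ φ, φ x = z (restrictToLittle 𝓛 τ φ)) (L : 𝓛) :
    ‖(L : X →L[𝕜] Y) x‖ ≤ ‖z‖ := by
  refine NormedSpace.norm_le_dual_bound 𝕜 _ (norm_nonneg z) fun ψ => ?_
  have h1 := hx (ψ ∘L (L : X →L[𝕜] Y))
  rw [ContinuousLinearMap.comp_apply] at h1
  rw [h1]
  refine z.le_of_opNorm_le_of_le le_rfl ?_
  refine ContinuousLinearMap.opNorm_le_bound _ (norm_nonneg ψ) fun y => ?_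
  exact ψ.le_of_opNorm_le_of_le le_rfl (Big.norm_apply_le 𝓛 (y : Big 𝓛) L)

/-- The bidual of `M₀` is isometric to `M`, by the adjoint of the restriction map `X* → M₀*`. -/
theorem exists_bidual_isometryEquiv [CompleteSpace X]
    (hrefl : Function.Surjective (NormedSpace.inclusionInDoubleDual 𝕜 X))
    (hT2 : @T2Space 𝓛 τ) (hlc : @LocallyCompactSpace 𝓛 τ)
    (heval : ∀ x : X, @Continuous 𝓛 Y τ _ (fun L : 𝓛 => (L : X →L[𝕜] Y) x))
    (happrox : ApproximationProperty 𝓛 τ) :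
    ∃ I : StrongDual 𝕜 (StrongDual 𝕜 (Little 𝓛 τ)) ≃ₗᵢ[𝕜] Big 𝓛,
      ∀ z (φ : StrongDual 𝕜 X), φ (Big.incl 𝓛 (I z)) = z (restrictToLittle 𝓛 τ φ) := by
  let j : Little 𝓛 τ →L[𝕜] X := Big.inclL 𝓛 ∘L (Little 𝓛 τ).subtypeL
  have hex : ∀ z : StrongDual 𝕜 (StrongDual 𝕜 (Little 𝓛 τ)), ∃ w : Big 𝓛,
      ‖w‖ ≤ ‖z‖ ∧ ∀ φ, φ (Big.incl 𝓛 w) = z (restrictToLittle 𝓛 τ φ) := by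
    intro z
    -- Composed with the restriction `X* → M₀*`, `z` is a functional on `X*`, hence a point of `X`.
    obtain ⟨x, hx⟩ := hrefl (z ∘L (ContinuousLinearMap.compL 𝕜 (Little 𝓛 τ) X 𝕜).flip j)
    have hx' : ∀ φ, φ x = z (restrictToLittle 𝓛 τ φ) := fun φ => DFunLike.congr_fun hx φ
    have hL := norm_apply_le_of_bidual hx'
    let w : Big 𝓛 := (⟨x, ‖z‖, by rintro _ ⟨L, rfl⟩; exact hL L⟩ : bigSubmodule 𝓛)
    exact ⟨w, Big.norm_le_of_forall (norm_nonneg z) hL, hx'⟩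
  choose I hI hIφ using hex
  have huniq : ∀ w w' : Big 𝓛, (∀ φ : StrongDual 𝕜 X, φ (Big.incl 𝓛 w) = φ (Big.incl 𝓛 w')) →
      w = w' := fun w w' h =>
    Big.incl_injective ((NormedSpace.inclusionInDoubleDualLi 𝕜 (E := X)).injective
      (ContinuousLinearMap.ext h))
  have hadd : ∀ z z', I (z + z') = I z + I z' := fun z z' =>
    huniq _ _ fun φ => by simp only [map_add, hIφ, add_apply]
  have hsmul : ∀ (c : 𝕜) z, I (c • z) = c • I z := fun c z =>
    huniq _ _ fun φ => by simp only [map_smul, hIφ, smul_apply]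
  have hinj : ∀ z, I z = 0 → z = 0 := fun z hz =>
    eq_zero_of_apply_restrictToLittle hT2 hlc heval fun φ => by rw [← hIφ, hz, map_zero, map_zero]
  -- Besides surjectivity, the norm bound on the preimage gives, by injectivity, the missing half of
  -- the isometry.
  have hinv : ∀ w : Big 𝓛, ∃ z, ‖z‖ ≤ ‖w‖ ∧ I z = w := fun w => by
    obtain ⟨u, huM, hu, hlim⟩ := happrox w
    obtain ⟨z, hz, hzφ⟩ := exists_bidual_of_tendsto (𝕜 := 𝕜) j
      (u := fun n => (⟨u n, huM n⟩ : Little 𝓛 τ)) hu hlim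
    exact ⟨z, hz, huniq _ _ fun φ => (hIφ z φ).trans (hzφ φ)⟩
  let I₀ : StrongDual 𝕜 (StrongDual 𝕜 (Little 𝓛 τ)) →ₗ[𝕜] Big 𝓛 :=
    { toFun := I, map_add' := hadd, map_smul' := hsmul }
  have hinj₀ : Function.Injective I₀ := (injective_iff_map_eq_zero I₀).2 hinj
  let I₁ : StrongDual 𝕜 (StrongDual 𝕜 (Little 𝓛 τ)) →ₗᵢ[𝕜] Big 𝓛 :=
    { I₀ with
      norm_map' := fun z => le_antisymm (hI z) (by
        obtain ⟨z', hz', h⟩ := hinv (I z)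
        rw [hinj₀ h] at hz'
        exact hz') }
  exact ⟨LinearIsometryEquiv.ofSurjective I₁ fun w => (hinv w).imp fun _ h => h.2, hIφ⟩

end Spaces

/-! ### The main theorem. -/

theorem theorem1p1 {𝕜 : Type*} [RCLike 𝕜]
    {X : Type*} [NormedAddCommGroup X] [NormedSpace 𝕜 X] [CompleteSpace X]
    {Y : Type*} [NormedAddCommGroup Y] [NormedSpace 𝕜 Y] [CompleteSpace Y]
    -- `X` is separable and reflexive
    (hsep : TopologicalSpace.SeparableSpace X)
    (hrefl : Function.Surjective (NormedSpace.inclusionInDoubleDual 𝕜 X))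
    -- the collection of operators, with its Hausdorff, locally compact, σ-compact topology
    (𝓛 : Set (X →L[𝕜] Y)) (τ : TopologicalSpace 𝓛)
    (hT2 : @T2Space 𝓛 τ) (hlc : @LocallyCompactSpace 𝓛 τ) (hσ : @SigmaCompactSpace 𝓛 τ)
    (heval : ∀ x : X, @Continuous 𝓛 Y τ _ (fun L : 𝓛 => (L : X →L[𝕜] Y) x))
    -- `M` is dense in `X`, and `M` with its own norm is continuously contained in `X`
    (hdense : Dense (bigSubmodule 𝓛 : Set X))
    [Big.ContinuouslyContained 𝓛]
    (happrox : ApproximationProperty 𝓛 τ) :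
    -- `M₀` is M-embedded
    IsMEmbedded 𝕜 (Little 𝓛 τ) ∧
    -- the bidual of `M₀` is `M`, by the adjoint of `J : X* → M₀*`, and `M₀` is an M-ideal in `M`
    (∃ I : StrongDual 𝕜 (StrongDual 𝕜 (Little 𝓛 τ)) ≃ₗᵢ[𝕜] Big 𝓛,
      (∀ z (φ : StrongDual 𝕜 X),
        φ (Big.incl 𝓛 (I z)) = z (restrictToLittle 𝓛 τ φ)) ∧
      ∀ x : Little 𝓛 τ, I (NormedSpace.inclusionInDoubleDual 𝕜 (Little 𝓛 τ) x) = x) ∧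
    IsMIdeal (Little 𝓛 τ) ∧
    -- `M₀*** = M₀* ⊕₁ M₀^⊥`
    IsCompl (canonicalImage 𝕜 (StrongDual 𝕜 (Little 𝓛 τ)))
      (annihilator (canonicalImage 𝕜 (Little 𝓛 τ))) ∧
    ∀ (f : StrongDual 𝕜 (Little 𝓛 τ)),
      ∀ s ∈ annihilator (canonicalImage 𝕜 (Little 𝓛 τ)),
        ‖NormedSpace.inclusionInDoubleDual 𝕜 (StrongDual 𝕜 (Little 𝓛 τ)) f + s‖ = ‖f‖ + ‖s‖ := by
  obtain ⟨I, hI⟩ := exists_bidual_isometryEquiv hrefl hT2 hlc heval happrox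
  have hIx : ∀ x : Little 𝓛 τ,
      I (NormedSpace.inclusionInDoubleDual 𝕜 (Little 𝓛 τ) x) = x := fun x =>
    Big.incl_injective ((NormedSpace.inclusionInDoubleDualLi 𝕜 (E := X)).injective
      (ContinuousLinearMap.ext fun φ => hI _ φ))
  -- `M` is isometric to a dual space, hence complete.
  have hcomplete : CompleteSpace (Big 𝓛) :=
    I.symm.toIsometryEquiv.completeSpace
  have hcomplete₀ : CompleteSpace (Little 𝓛 τ) := (isClosed_little 𝓛 τ).completeSpace_coe
  have hnorm : ∀ (f : StrongDual 𝕜 (Little 𝓛 τ)),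
      ∀ s ∈ annihilator (canonicalImage 𝕜 (Little 𝓛 τ)),
        ‖NormedSpace.inclusionInDoubleDual 𝕜 (StrongDual 𝕜 (Little 𝓛 τ)) f + s‖ = ‖f‖ + ‖s‖ := by
    refine fun f s hs => norm_add_of_approx (fun x z f ε hx hz hε => ?_) f hs
    obtain ⟨φ, hφ⟩ := exists_norm_sub_restrictToLittle_le hT2 hlc heval f
      (show 0 < ε / (2 * (2 + ε)) by positivity)
    obtain ⟨y, hy, hlt, hle, hle'⟩ := exists_little_norm_add_sub_le heval happrox x.2 hx
      ((I.norm_map z).trans_le hz) hε (show 0 < ε / (2 * (‖φ‖ + 1)) by positivity)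
    let y₀ : Little 𝓛 τ := ⟨y, hy⟩
    set d := z - NormedSpace.inclusionInDoubleDual 𝕜 (Little 𝓛 τ) y₀ with hd
    have hId : I d = I z - y := by rw [hd, map_sub, hIx]
    refine ⟨y₀, ?_, ?_⟩
    · have h1 : z f - f y₀ = d (f - restrictToLittle 𝓛 τ φ) + φ (Big.incl 𝓛 (I d)) := by
        rw [hI, map_sub, sub_add_cancel]
        rfl
      have h2 : ‖d‖ ≤ 2 + ε := by
        rw [← I.norm_map, hId]
        linarith
      have h3 := d.le_of_opNorm_le_of_le h2 hφ
      have h4 := φ.le_of_opNorm_le_of_le (show ‖φ‖ ≤ ‖φ‖ + 1 by linarith) hlt.le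
      have h5 : (2 + ε) * (ε / (2 * (2 + ε))) = ε / 2 := by field_simp
      have h6 : (‖φ‖ + 1) * (ε / (2 * (‖φ‖ + 1))) = ε / 2 := by field_simp
      rw [h1, hId]
      rw [h5] at h3
      rw [h6] at h4
      exact (norm_add_le _ _).trans (by linarith)
    · rw [← I.norm_map, map_add, hIx]
      refine le_of_eq_of_le (congrArg norm ?_) hle'
      rw [Submodule.coe_sub]
      abel
  have hemb := isMEmbedded_of_norm_add hnorm
  refine ⟨hemb, ⟨I, hI, hIx⟩, hemb.isMIdeal.of_linearIsometryEquiv I fun z => ?_,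
    isCompl_canonicalImage_annihilator 𝕜 _, hnorm⟩
  constructor
  · rintro ⟨x, rfl⟩
    exact (hIx x).symm ▸ x.2
  · exact fun hz => ⟨⟨I z, hz⟩, I.injective (hIx _)⟩
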